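/- Let $G$ be a nonempty groupoid, that is, a small category with at least one object in which every morphism is invertible, with set of objects $G_0$ and source and range maps $s,r$, and let $R$ be a nonzero unital commutative ring. The groupoid ring $R[G]$ consists of the finite formal sums $\sum_{g} a_g\delta_g$ with $g$ ranging over the morphisms of $G$ and $a_g\in R$, with multiplication determined by $a\delta_g\cdot b\delta_h=ab\,\delta_{gh}$ if $s(g)=r(h)$, and $0$ otherwise. For $e\in G_0$ let $G_e^e=\{g\in G: s(g)=r(g)=e\}$ be the isotropy group and $\mathcal O_e=\{f\in G_0:\exists g\in G,\ s(g)=e,\ r(g)=f\}$ the orbit of $e$. A subset $X\subseteq G_0$ is called $R$-dense if for every nonzero $a=\sum_g a_g\delta_g\in R[G]$ there is a $g$ with $a_g\neq 0$ and $s(g)\in X$. A (not necessarily unital) ring $S$ is called prime if there are no nonzero two-sided ideals $I,J$ of $S$ with $IJ=\{0\}$. Then the following statements are equivalent: (i) $R[G]$ is prime; (ii) there is some $e\in G_0$ such that $\mathcal O_e$ is $R$-dense and the group ring $R[G_e^e]$ is prime; (iii) there is some $e\in G_0$ such that $\mathcal O_e$ is $R$-dense, $R$ is an integral domain, and $G_e^e$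 has no nontrivial finite normal subgroup. -/

import Mathlib

open CategoryTheory

universe u v w

/-- A ring (not assumed unital) is prime if it has no nonzero two-sided ideals `I`, `J`
with `I J = {0}`. The product `I J` is zero iff `x * y = 0` for all `x ∈ I`, `y ∈ J`. -/
def IsPrimeRing (S : Type u) [NonUnitalRing S] : Prop :=
  ¬ ∃ I J : TwoSidedIdeal S, I ≠ ⊥ ∧ J ≠ ⊥ ∧ ∀ x ∈ I, ∀ y ∈ J, x * y = 0

/-- The morphisms of a groupoid, bundled with their source and range. -/
structure GroupoidMor (C : Type v) [Groupoid.{w} C] where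
  source : C
  range : C
  hom : source ⟶ range

namespace GroupoidMor

variable {C : Type v} [Groupoid.{w} C]

/-- The product `g h` (first `h`, then `g`) of a composable pair, `s(g) = r(h)`. -/
def comp (g h : GroupoidMor C) (hgh : g.source = h.range) : GroupoidMor C :=
  ⟨h.source, g.range, h.hom ≫ eqToHom hgh.symm ≫ g.hom⟩

theorem comp_assoc (g h k : GroupoidMor C) (h₁ : g.source = h.range) (h₂ : h.source = k.range) :
    comp (comp g h h₁) k h₂ = comp g (comp h k h₂) h₁ := by
  simp [comp]

end GroupoidMor

/-- The groupoid ring `R[G]`: finite formal sums `∑ a_g δ_g` over the morphisms `g` of `G`. -/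
def GroupoidRing (R : Type u) (C : Type v) [Ring R] [Groupoid.{w} C] : Type (max u v w) :=
  GroupoidMor C →₀ R

namespace GroupoidRing

variable {R : Type u} {C : Type v} [Ring R] [Groupoid.{w} C]

noncomputable instance : AddCommGroup (GroupoidRing R C) :=
  inferInstanceAs (AddCommGroup (GroupoidMor C →₀ R))

/-- The coefficient `a_g` of `a = ∑ a_g δ_g`. -/
def coeff (a : GroupoidRing R C) (g : GroupoidMor C) : R :=
  (show GroupoidMor C →₀ R from a) g

/-- The element `x δ_g`. -/
noncomputable def single (g : GroupoidMor C) (x : R) : GroupoidRing R C :=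
  (Finsupp.single g x : GroupoidMor C →₀ R)

open Classical in
/-- `(x δ_g) (y δ_h)`, which is `x y δ_{gh}` if `g`, `h` are composable, and `0` otherwise. -/
noncomputable def singleMul (g : GroupoidMor C) (x : R) (h : GroupoidMor C) (y : R) :
    GroupoidRing R C :=
  if hgh : g.source = h.range then single (g.comp h hgh) (x * y) else 0

theorem single_zero (g : GroupoidMor C) : single g (0 : R) = 0 :=
  Finsupp.single_zero g

theorem single_add (g : GroupoidMor C) (x y : R) :
    single g (x + y) = single g x + single g y :=
  Finsupp.single_add g x y

theorem singleMul_zero_left (g : GroupoidMor C) (h : GroupoidMor C) (y : R) :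
    singleMul g 0 h y = 0 := by
  simp [singleMul, single_zero]

theorem singleMul_zero_right (g : GroupoidMor C) (x : R) (h : GroupoidMor C) :
    singleMul g x h 0 = 0 := by
  simp [singleMul, single_zero]

theorem singleMul_add_left (g : GroupoidMor C) (x x' : R) (h : GroupoidMor C) (y : R) :
    singleMul g (x + x') h y = singleMul g x h y + singleMul g x' h y := by
  unfold singleMul
  split_ifs
  · rw [add_mul, single_add]
  · simp

theorem singleMul_add_right (g : GroupoidMor C) (x : R) (h : GroupoidMor C) (y y' : R) :
    singleMul g x h (y + y') = singleMul g x h y + singleMul g x h y' := by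
  unfold singleMul
  split_ifs
  · rw [mul_add, single_add]
  · simp

/-- The biadditive extension of `singleMul`. -/
noncomputable instance : Mul (GroupoidRing R C) where
  mul a b := Finsupp.sum (show GroupoidMor C →₀ R from a) fun g x =>
    Finsupp.sum (show GroupoidMor C →₀ R from b) fun h y => singleMul g x h y

theorem mul_def (a b : GroupoidRing R C) :
    a * b = Finsupp.sum (show GroupoidMor C →₀ R from a) fun g x =>
      Finsupp.sum (show GroupoidMor C →₀ R from b) fun h y => singleMul g x h y :=
  rfl

theorem single_mul_single (g : GroupoidMor C) (x : R) (h : GroupoidMor C) (y : R) :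
    single g x * single h y = singleMul g x h y := by
  rw [mul_def]
  refine (Finsupp.sum_single_index ?_).trans (Finsupp.sum_single_index ?_)
  · exact Finset.sum_eq_zero fun _ _ => singleMul_zero_left _ _ _
  · exact singleMul_zero_right g x h

protected theorem zero_mul (a : GroupoidRing R C) : 0 * a = 0 :=
  Finsupp.sum_zero_index

protected theorem mul_zero (a : GroupoidRing R C) : a * 0 = 0 := by
  rw [mul_def]
  exact Finset.sum_eq_zero fun _ _ => Finsupp.sum_zero_index

protected theorem add_mul (a b c : GroupoidRing R C) : (a + b) * c = a * c + b * c := by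
  classical
  refine Finsupp.sum_add_index' (fun g => ?_) (fun g x y => ?_)
  · exact Finset.sum_eq_zero fun _ _ => singleMul_zero_left _ _ _
  · simp only [singleMul_add_left]
    exact Finsupp.sum_add

protected theorem mul_add (a b c : GroupoidRing R C) : a * (b + c) = a * b + a * c := by
  classical
  refine Eq.trans (Finset.sum_congr rfl fun g _ => ?_) Finset.sum_add_distrib
  exact Finsupp.sum_add_index' (fun h => singleMul_zero_right _ _ h)
    (fun h x y => singleMul_add_right _ _ h x y)

theorem induction_linear {p : GroupoidRing R C → Prop} (a : GroupoidRing R C) (h0 : p 0)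
    (hadd : ∀ a b, p a → p b → p (a + b)) (hs : ∀ g x, p (single g x)) : p a :=
  Finsupp.induction_linear (motive := p) a h0 hadd hs

protected theorem mul_assoc (a b c : GroupoidRing R C) : a * b * c = a * (b * c) := by
  induction a using induction_linear with
  | h0 => simp only [GroupoidRing.zero_mul]
  | hadd a a' ha ha' => simp only [GroupoidRing.add_mul, ha, ha']
  | hs g x =>
    induction b using induction_linear with
    | h0 => simp only [GroupoidRing.zero_mul, GroupoidRing.mul_zero]
    | hadd b b' hb hb' => simp only [GroupoidRing.add_mul, GroupoidRing.mul_add, hb, hb']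
    | hs h y =>
      induction c using induction_linear with
      | h0 => simp only [GroupoidRing.mul_zero]
      | hadd c c' hc hc' => simp only [GroupoidRing.mul_add, hc, hc']
      | hs k z =>
        rw [single_mul_single, single_mul_single]
        unfold singleMul
        by_cases h₁ : g.source = h.range <;> by_cases h₂ : h.source = k.range
        · have h₃ : (g.comp h h₁).source = k.range := h₂
          have h₄ : g.source = (h.comp k h₂).range := h₁
          rw [dif_pos h₁, dif_pos h₂, single_mul_single, single_mul_single]
          unfold singleMul
          rw [dif_pos h₃, dif_pos h₄, mul_assoc]
          exact congrArg (fun m => single m (x * (y * z))) (GroupoidMor.comp_assoc g h k h₁ h₂)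
        · have h₃ : ¬ (g.comp h h₁).source = k.range := h₂
          rw [dif_pos h₁, dif_neg h₂, single_mul_single, GroupoidRing.mul_zero]
          unfold singleMul
          rw [dif_neg h₃]
        · have h₄ : ¬ g.source = (h.comp k h₂).range := h₁
          rw [dif_neg h₁, dif_pos h₂, single_mul_single, GroupoidRing.zero_mul]
          unfold singleMul
          rw [dif_neg h₄]
        · rw [dif_neg h₁, dif_neg h₂, GroupoidRing.zero_mul, GroupoidRing.mul_zero]

noncomputable instance : NonUnitalRing (GroupoidRing R C) where
  left_distrib := GroupoidRing.mul_add
  right_distrib := GroupoidRing.add_mul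
  zero_mul := GroupoidRing.zero_mul
  mul_zero := GroupoidRing.mul_zero
  mul_assoc := GroupoidRing.mul_assoc

end GroupoidRing

/-- A set `X` of objects is `R`-dense if every nonzero `a = ∑ a_g δ_g` in `R[G]` has some
`a_g ≠ 0` with `s(g) ∈ X`. -/
def IsRDense (R : Type u) {C : Type v} [Ring R] [Groupoid.{w} C] (X : Set C) : Prop :=
  ∀ a : GroupoidRing R C, a ≠ 0 → ∃ g : GroupoidMor C, a.coeff g ≠ 0 ∧ g.source ∈ X

/-- The orbit of an object `e`: all `f` for which there is a morphism from `e` to `f`. -/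
def groupoidOrbit {C : Type v} [Groupoid.{w} C] (e : C) : Set C :=
  {f | Nonempty (e ⟶ f)}

/-!
If `R[G]` is prime, then `δ_f t δ_e = 0` for all `t` is impossible, so that any two objects are
joined by a morphism and every orbit is `R`-dense. Conversely, if the orbit of `e` is `R`-dense,
then every nonzero `t` has a nonzero coefficient at a morphism `x ⟶ y` with `x` and `y` in this
orbit, and a suitable map `t ↦ δ_p t δ_q` moves this coefficient into the group ring of the isotropy
group at `e`. Hence primeness passes back and forth between the two rings.

What remains is Connell's theorem on the group ring of `Γ`. If `N` is a finite normal subgroup, then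
the sum of its elements is central and annihilates `δ_n - 1` for `n ∈ N`. Conversely, assume that
`N` is always trivial. If `a R[Γ] b = 0`, then `a₀ b = 0`, where `a₀` is the part of `a` that is
supported on the elements with finitely many conjugates. Otherwise the conjugators that carry the
support of `a - a₀` into a finite set would cover a subgroup of finite index, which Neumann's lemma
on coverings by cosets forbids. The elements with finitely many conjugates form a torsion-free
abelian group, by the theorems of Schur and Dietzmann. Its finitely generated subgroups have unique
products, and a uniquely represented product isolates nonzero coefficients `c` of `a` and `d` of `b`
with `c r d = 0` for all `r` in `R`.
-/

/-! ### Prime rings -/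

theorem exists_mem_ne_zero_of_ne_bot {S : Type u} [NonUnitalRing S] {I : TwoSidedIdeal S}
    (hI : I ≠ ⊥) : ∃ a ∈ I, a ≠ 0 := by
  by_contra! h
  exact hI (eq_bot_iff.2 fun x hx => (TwoSidedIdeal.mem_bot S).2 (h x hx))

/-- The right annihilator of a two-sided ideal. -/
def rightAnnihilator {S : Type u} [NonUnitalRing S] (I : TwoSidedIdeal S) : TwoSidedIdeal S :=
  .mk' {y | ∀ x ∈ I, x * y = 0}
    (fun x _ => mul_zero x)
    (fun hy hz x hx => by rw [mul_add, hy x hx, hz x hx, add_zero])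
    (fun hy x hx => by rw [mul_neg, hy x hx, neg_zero])
    (fun {s _} hy x hx => by rw [← mul_assoc, hy _ (I.mul_mem_right x s hx)])
    (fun hy x hx => by rw [← mul_assoc, hy x hx, zero_mul])

theorem mem_rightAnnihilator {S : Type u} [NonUnitalRing S] {I : TwoSidedIdeal S} {y : S} :
    y ∈ rightAnnihilator I ↔ ∀ x ∈ I, x * y = 0 :=
  TwoSidedIdeal.mem_mk' ..

theorem IsPrimeRing.rightAnnihilator_eq_bot {S : Type u} [NonUnitalRing S] (hS : IsPrimeRing S)
    {I : TwoSidedIdeal S} (hI : I ≠ ⊥) : rightAnnihilator I = ⊥ := by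
  by_contra hJ
  exact hS ⟨I, rightAnnihilator I, hI, hJ, fun x hx y hy => mem_rightAnnihilator.1 hy x hx⟩

theorem IsPrimeRing.eq_zero_or_eq_zero {S : Type u} [NonUnitalRing S] (hS : IsPrimeRing S)
    {a b : S} (hab : ∀ s, a * s * b = 0) : a = 0 ∨ b = 0 := by
  refine or_iff_not_imp_left.2 fun ha => ?_
  let I : TwoSidedIdeal S := .mk' {x | ∀ s, x * s * b = 0}
    (fun s => by rw [zero_mul, zero_mul])
    (fun hx hy s => by rw [add_mul, add_mul, hx, hy, add_zero])
    (fun hx s => by rw [neg_mul, neg_mul, hx, neg_zero])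
    (fun {r x} hx s => by rw [mul_assoc r, mul_assoc r, hx, mul_zero])
    (fun {x r} hx s => by rw [mul_assoc x, hx])
  have mem_I {x : S} : x ∈ I ↔ ∀ s, x * s * b = 0 := TwoSidedIdeal.mem_mk' ..
  have hI : I ≠ ⊥ := fun h => ha ((TwoSidedIdeal.mem_bot S).1 (h ▸ mem_I.2 hab))
  have eq_zero {y : S} (hy : ∀ x ∈ I, x * y = 0) : y = 0 := by
    rw [← TwoSidedIdeal.mem_bot S, ← hS.rightAnnihilator_eq_bot hI]
    exact mem_rightAnnihilator.2 hy
  have mul_b (s : S) : s * b = 0 := eq_zero fun x hx => by rw [← mul_assoc, mem_I.1 hx]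
  exact eq_zero fun x _ => mul_b x

theorem isPrimeRing_iff {S : Type u} [NonUnitalRing S] :
    IsPrimeRing S ↔ ∀ a b : S, (∀ s, a * s * b = 0) → a = 0 ∨ b = 0 := by
  refine ⟨fun hS a b => hS.eq_zero_or_eq_zero, ?_⟩
  rintro h ⟨I, J, hI, hJ, hIJ⟩
  obtain ⟨a, haI, ha⟩ := exists_mem_ne_zero_of_ne_bot hI
  obtain ⟨b, hbJ, hb⟩ := exists_mem_ne_zero_of_ne_bot hJ
  exact (h a b fun s => hIJ _ (I.mul_mem_right a s haI) b hbJ).elim ha hb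

theorem isPrimeRing_iff_isDomain {R : Type u} [CommRing R] [Nontrivial R] :
    IsPrimeRing R ↔ IsDomain R := by
  refine isPrimeRing_iff.trans ⟨fun h => ?_, fun _ a b hab => ?_⟩
  · have : NoZeroDivisors R :=
      ⟨fun {a b} hab => h a b fun s => by rw [mul_right_comm, hab, zero_mul]⟩
    exact NoZeroDivisors.to_isDomain R
  · simpa using hab 1

/-! ### Elements with finitely many conjugates -/

section FCCenter

open scoped commutatorElement Pointwise

variable {Γ : Type u} [Group Γ]

variable (Γ) in
/-- The FC-center of a group: the subgroup of the elements with finitely many conjugates. -/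
def fcCenter : Subgroup Γ where
  carrier := {g | (conjugatesOf g).Finite}
  one_mem' := (Set.finite_singleton 1).subset fun _ h => isConj_one_right.1 h
  mul_mem' {g h} hg hh := by
    refine (Set.Finite.mul hg hh).subset fun y hy => ?_
    obtain ⟨c, rfl⟩ := isConj_iff.1 hy
    rw [← conj_mul]
    exact Set.mul_mem_mul (isConj_iff.2 ⟨c, rfl⟩) (isConj_iff.2 ⟨c, rfl⟩)
  inv_mem' {g} hg := by
    refine (Set.Finite.inv hg).subset fun y hy => ?_
    obtain ⟨c, rfl⟩ := isConj_iff.1 hy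
    exact isConj_iff.2 ⟨c, by rw [← conj_inv, inv_inv]⟩

theorem mem_fcCenter {g : Γ} : g ∈ fcCenter Γ ↔ (conjugatesOf g).Finite :=
  Iff.rfl

theorem mem_fcCenter_iff_finiteIndex_centralizer {g : Γ} :
    g ∈ fcCenter Γ ↔ (Subgroup.centralizer {g}).FiniteIndex := by
  have index_eq : (Subgroup.centralizer {g}).index = (conjugatesOf g).ncard := by
    simpa only [ConjAct.stabilizer_eq_centralizer, ConjAct.orbit_eq_carrier_conjClasses] using!
      MulAction.index_stabilizer (ConjAct Γ) g
  rw [mem_fcCenter, Subgroup.finiteIndex_iff, index_eq]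
  exact ⟨fun h => Set.ncard_ne_zero_of_mem mem_conjugatesOf_self h, Set.finite_of_ncard_ne_zero⟩

instance fcCenter_normal : (fcCenter Γ).Normal where
  conj_mem g hg c := by
    rwa [mem_fcCenter, ← (isConj_iff.2 ⟨c, rfl⟩ : IsConj g (c * g * c⁻¹)).conjugatesOf_eq]

theorem finiteIndex_centralizer_of_subset_fcCenter {S : Set Γ} (hfin : S.Finite)
    (hS : S ⊆ fcCenter Γ) : (Subgroup.centralizer S).FiniteIndex := by
  have := hfin.to_subtype
  rw [Subgroup.centralizer_eq_iInf, iInf_subtype']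
  exact Subgroup.finiteIndex_iInf fun s => mem_fcCenter_iff_finiteIndex_centralizer.1 (hS s.2)

theorem finite_conjugatesOfSet {S : Set Γ} (hfin : S.Finite) (hS : S ⊆ fcCenter Γ) :
    (Group.conjugatesOfSet S).Finite :=
  hfin.biUnion hS

theorem finiteIndex_center_normalClosure {S : Set Γ} (hfin : S.Finite) (hS : S ⊆ fcCenter Γ) :
    (Subgroup.center (Subgroup.normalClosure S)).FiniteIndex := by
  have hC : (Subgroup.centralizer (Group.conjugatesOfSet S)).FiniteIndex :=
    finiteIndex_centralizer_of_subset_fcCenter (finite_conjugatesOfSet hfin hS)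
      (Group.conjugatesOfSet_subset hS)
  rw [← Subgroup.centralizer_closure] at hC
  change (Subgroup.centralizer (Subgroup.normalClosure S : Set Γ)).FiniteIndex at hC
  refine Subgroup.finiteIndex_of_le (H := (Subgroup.centralizer
    (Subgroup.normalClosure S : Set Γ)).subgroupOf (Subgroup.normalClosure S)) fun x hx => ?_
  exact Subgroup.mem_center_iff.2 fun y =>
    Subtype.ext (Subgroup.mem_centralizer_iff.1 (Subgroup.mem_subgroupOf.1 hx) y y.2)

theorem commutatorElement_mul_mul_of_mem_center (x y : Γ) {z t : Γ} (hz : z ∈ Subgroup.center Γ)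
    (ht : t ∈ Subgroup.center Γ) : ⁅x * z, y * t⁆ = ⁅x, y⁆ := by
  have mul_left (a b : Γ) {c : Γ} (hc : c ∈ Subgroup.center Γ) : ⁅a * c, b⁆ = ⁅a, b⁆ := by
    rw [commutatorElement_def, mul_assoc a, ← Subgroup.mem_center_iff.1 hc b]
    group
  rw [mul_left _ _ hz, ← commutatorElement_inv, mul_left _ _ ht, commutatorElement_inv]

theorem finite_commutatorSet_of_finiteIndex_center [(Subgroup.center Γ).FiniteIndex] :
    (commutatorSet Γ).Finite := by
  have : Finite (Γ ⧸ Subgroup.center Γ) := Subgroup.finite_quotient_of_finiteIndex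
  refine (Set.finite_range
    fun p : (Γ ⧸ Subgroup.center Γ) × (Γ ⧸ Subgroup.center Γ) => ⁅p.1.out, p.2.out⁆).subset ?_
  rintro _ ⟨x, y, rfl⟩
  obtain ⟨z, hz⟩ := QuotientGroup.mk_out_eq_mul (Subgroup.center Γ) x
  obtain ⟨t, ht⟩ := QuotientGroup.mk_out_eq_mul (Subgroup.center Γ) y
  refine ⟨(x, y), ?_⟩
  beta_reduce
  rw [hz, ht, commutatorElement_mul_mul_of_mem_center x y z.2 t.2]

open scoped IsMulCommutative in
theorem finite_closure_of_commute {S : Set Γ} (hfin : S.Finite)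
    (hcomm : ∀ x ∈ S, ∀ y ∈ S, x * y = y * x) (htors : ∀ x ∈ S, IsOfFinOrder x) :
    Finite (Subgroup.closure S) := by
  have := hfin.to_subtype
  have := Subgroup.isMulCommutative_closure hcomm
  have := Group.closure_finite_fg S
  refine CommGroup.finite_of_fg_isMulTorsion _ fun ⟨x, hx⟩ => ?_
  induction hx using Subgroup.closure_induction with
  | mem x hx => exact Submonoid.isOfFinOrder_coe.1 (htors x hx)
  | one => exact IsOfFinOrder.one
  | mul x y hx hy ihx ihy => exact ihx.mul ihy
  | inv x hx ihx => exact ihx.inv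

theorem mul_comm_of_mem_fcCenter (hΓ : ∀ N : Subgroup Γ, N.Normal → Finite N → N = ⊥) {x y : Γ}
    (hx : x ∈ fcCenter Γ) (hy : y ∈ fcCenter Γ) : x * y = y * x := by
  have hfin : ({x, y} : Set Γ).Finite := Set.toFinite _
  have subset : ({x, y} : Set Γ) ⊆ Subgroup.normalClosure {x, y} := Subgroup.subset_normalClosure
  set H := Subgroup.normalClosure {x, y}
  have : (Subgroup.center H).FiniteIndex :=
    finiteIndex_center_normalClosure hfin (Set.pair_subset hx hy)
  have : Finite (commutatorSet H) := finite_commutatorSet_of_finiteIndex_center.to_subtype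
  -- Schur's theorem
  have : Finite (commutator H) := inferInstance
  have commutator_eq_bot : (commutator H).map H.subtype = ⊥ :=
    hΓ _ ConjAct.normal_of_characteristic_of_normal
      ((Set.toFinite (commutator H : Set H)).image H.subtype).to_subtype
  rw [Subgroup.map_eq_bot_iff_of_injective _ H.subtype_injective, commutator_def,
    Subgroup.commutator_eq_bot_iff_le_centralizer] at commutator_eq_bot
  exact congrArg Subtype.val (Subgroup.mem_centralizer_iff.1
    (commutator_eq_bot (Subgroup.mem_top ⟨y, subset (by simp)⟩)) ⟨x, subset (by simp)⟩ trivial)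

theorem eq_one_of_mem_fcCenter_of_isOfFinOrder
    (hΓ : ∀ N : Subgroup Γ, N.Normal → Finite N → N = ⊥) {x : Γ} (hx : x ∈ fcCenter Γ)
    (hord : IsOfFinOrder x) : x = 1 := by
  have subset : Group.conjugatesOfSet {x} ⊆ fcCenter Γ :=
    Group.conjugatesOfSet_subset (Set.singleton_subset_iff.2 hx)
  have hfin : Finite (Subgroup.normalClosure {x}) := by
    refine finite_closure_of_commute
      (finite_conjugatesOfSet (Set.finite_singleton x) (Set.singleton_subset_iff.2 hx))
      (fun y hy z hz => mul_comm_of_mem_fcCenter hΓ (subset hy) (subset hz)) fun y hy => ?_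
    obtain ⟨_, rfl, hxy⟩ := Group.mem_conjugatesOfSet_iff.1 hy
    exact hxy.isOfFinOrder hord
  rw [← Subgroup.mem_bot, ← hΓ _ Subgroup.normalClosure_normal hfin]
  exact Subgroup.subset_normalClosure rfl

open scoped IsMulCommutative in
theorem uniqueProds_closure_of_subset_fcCenter
    (hΓ : ∀ N : Subgroup Γ, N.Normal → Finite N → N = ⊥) {S : Set Γ} (hfin : S.Finite)
    (hS : S ⊆ fcCenter Γ) : UniqueProds (Subgroup.closure S) := by
  have := hfin.to_subtype
  have := Subgroup.isMulCommutative_closure fun x hx y hy =>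
    mul_comm_of_mem_fcCenter hΓ (hS hx) (hS hy)
  have := Group.closure_finite_fg S
  have : IsMulTorsionFree (Subgroup.closure S) :=
    isMulTorsionFree_iff_not_isOfFinOrder.2 fun x hx hord => hx <| Subtype.ext <|
      eq_one_of_mem_fcCenter_of_isOfFinOrder hΓ ((Subgroup.closure_le _).2 hS x.2)
        (Submonoid.isOfFinOrder_coe.2 hord)
  infer_instance

theorem inv_mul_mem_centralizer_of_conj_eq {g x y : Γ} (h : x * g * x⁻¹ = y * g * y⁻¹) :
    y⁻¹ * x ∈ Subgroup.centralizer {g} := by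
  rw [Subgroup.mem_centralizer_singleton_iff]
  calc y⁻¹ * x * g = y⁻¹ * (x * g * x⁻¹) * x := by group
    _ = g * (y⁻¹ * x) := by rw [h]; group

theorem exists_mem_forall_conj_notMem {W : Subgroup Γ} [W.FiniteIndex] {A : Finset Γ}
    (hA : ∀ g ∈ A, g ∉ fcCenter Γ) (T : Finset Γ) : ∃ x ∈ W, ∀ g ∈ A, x * g * x⁻¹ ∉ T := by
  by_contra! hconj
  let C (g : Γ) : Subgroup W := (Subgroup.centralizer {g}).subgroupOf W
  have exists_rep (p : Γ × Γ) :
      ∃ y : W, ∀ x : W, (x : Γ) * p.1 * (x : Γ)⁻¹ = p.2 → y⁻¹ * x ∈ C p.1 := by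
    by_cases hp : ∃ y : W, (y : Γ) * p.1 * (y : Γ)⁻¹ = p.2
    · obtain ⟨y, hy⟩ := hp
      exact ⟨y, fun x hx => inv_mul_mem_centralizer_of_conj_eq (hx.trans hy.symm)⟩
    · exact ⟨1, fun x hx => absurd ⟨x, hx⟩ hp⟩
  choose rep hrep using exists_rep
  have hcover : ⋃ p ∈ A ×ˢ T, rep p • (C p.1 : Set W) = Set.univ := by
    refine Set.eq_univ_of_forall fun x => ?_
    obtain ⟨g, hg, ht⟩ := hconj x x.2
    exact Set.mem_biUnion (Finset.mem_coe.2 (Finset.mk_mem_product hg ht))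
      ((mem_leftCoset_iff _).2 (hrep _ x rfl))
  -- B. H. Neumann: in a finite covering by cosets, some subgroup has finite index
  obtain ⟨⟨g, t⟩, hgt, hindex⟩ := Subgroup.exists_finiteIndex_of_leftCoset_cover hcover
  refine hA g (Finset.mem_product.1 hgt).1
    (mem_fcCenter_iff_finiteIndex_centralizer.2 ⟨?_⟩)
  rw [← Subgroup.relIndex_top_right]
  exact Subgroup.relIndex_ne_zero_trans hindex.index_ne_zero
    (by rw [Subgroup.relIndex_top_right]; exact Subgroup.FiniteIndex.index_ne_zero)

theorem exists_uniqueMul_of_subset_subgroup {H : Subgroup Γ} [UniqueProds H] {A B : Finset Γ}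
    (hA : A.Nonempty) (hAH : ∀ g ∈ A, g ∈ H) (hB : ∃ g ∈ B, g ∈ H) :
    ∃ g ∈ A, ∃ h ∈ B, UniqueMul A B g h := by
  have hinj : Function.Injective (Subtype.val : H → Γ) := Subtype.val_injective
  obtain ⟨g₀, hg₀⟩ := hA
  obtain ⟨h₀, hh₀, hh₀H⟩ := hB
  obtain ⟨g, hg, h, hh, hunique⟩ := UniqueProds.uniqueMul_of_nonempty
    (A := A.preimage _ hinj.injOn) (B := B.preimage _ hinj.injOn)
    ⟨⟨g₀, hAH _ hg₀⟩, Finset.mem_preimage.2 hg₀⟩ ⟨⟨h₀, hh₀H⟩, Finset.mem_preimage.2 hh₀⟩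
  refine ⟨g, Finset.mem_preimage.1 hg, h, Finset.mem_preimage.1 hh, fun x y hx hy hxy => ?_⟩
  have hyH : y ∈ H :=
    (H.mul_mem_cancel_left (hAH x hx)).1 (hxy ▸ H.mul_mem g.2 h.2)
  obtain ⟨hxg, hyh⟩ := hunique (a := ⟨x, hAH x hx⟩) (b := ⟨y, hyH⟩) (Finset.mem_preimage.2 hx)
    (Finset.mem_preimage.2 hy) (Subtype.ext hxy)
  exact ⟨congrArg Subtype.val hxg, congrArg Subtype.val hyh⟩

end FCCenter

/-! ### Prime group rings -/

section GroupRing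

open MonoidAlgebra

variable {R : Type u} {Γ : Type v} [Ring R] [Group Γ]

theorem commute_single_one_of_mem_centralizer {a : MonoidAlgebra R Γ} {x : Γ}
    (hx : x ∈ Subgroup.centralizer (a.coeff.support : Set Γ)) : Commute (single x 1) a := by
  rw [← sum_coeff_single a]
  refine Commute.sum_right _ _ _ fun g hg => single_commute_single ?_ (Commute.one_left _)
  exact (Subgroup.mem_centralizer_iff.1 hx g hg).symm

open Classical in
/-- The part of an element of a group ring that is supported on the FC-center. -/
noncomputable def fcPart (a : MonoidAlgebra R Γ) : MonoidAlgebra R Γ :=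
  ofCoeff (a.coeff.filter (· ∈ fcCenter Γ))

theorem coeff_fcPart_of_mem (a : MonoidAlgebra R Γ) {g : Γ} (hg : g ∈ fcCenter Γ) :
    (fcPart a).coeff g = a.coeff g := by
  classical exact Finsupp.filter_apply_pos _ _ hg

theorem coeff_fcPart_of_notMem (a : MonoidAlgebra R Γ) {g : Γ} (hg : g ∉ fcCenter Γ) :
    (fcPart a).coeff g = 0 := by
  classical exact Finsupp.filter_apply_neg _ _ hg

theorem support_fcPart_subset (a : MonoidAlgebra R Γ) :
    ((fcPart a).coeff.support : Set Γ) ⊆ fcCenter Γ := fun _ hg =>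
  by_contra fun h => Finsupp.mem_support_iff.1 hg (coeff_fcPart_of_notMem a h)

theorem notMem_fcCenter_of_mem_support_sub_fcPart (a : MonoidAlgebra R Γ) {g : Γ}
    (hg : g ∈ (a - fcPart a).coeff.support) : g ∉ fcCenter Γ := fun h =>
  Finsupp.mem_support_iff.1 hg <| by
    rw [coeff_sub, Finsupp.sub_apply, coeff_fcPart_of_mem a h, sub_self]

theorem fcPart_mul_eq_zero {a b : MonoidAlgebra R Γ} (h : ∀ x, a * single x 1 * b = 0) :
    fcPart a * b = 0 := by
  classical
  refine coeff_injective (Finsupp.ext fun z => ?_)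
  have : (Subgroup.centralizer ((fcPart a).coeff.support : Set Γ)).FiniteIndex :=
    finiteIndex_centralizer_of_subset_fcCenter (Finset.finite_toSet _) (support_fcPart_subset a)
  obtain ⟨x, hx, hconj⟩ := exists_mem_forall_conj_notMem
    (W := Subgroup.centralizer ((fcPart a).coeff.support : Set Γ))
    (fun _ => notMem_fcCenter_of_mem_support_sub_fcPart a)
    (b.coeff.support.image fun k => z * k⁻¹)
  have fcPart_conj : single x 1 * fcPart a * single x⁻¹ 1 = fcPart a := by
    rw [(commute_single_one_of_mem_centralizer hx).eq, mul_assoc, single_mul_single,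
      mul_inv_cancel, mul_one, ← one_def, mul_one]
  have decomp : fcPart a * b + single x 1 * (a - fcPart a) * single x⁻¹ 1 * b = 0 := by
    rw [mul_sub, sub_mul, sub_mul, fcPart_conj, add_sub_cancel, mul_assoc (single x 1),
      mul_assoc (single x 1), h, mul_zero]
  have coeff_eq_zero : (single x 1 * (a - fcPart a) * single x⁻¹ 1 * b).coeff z = 0 := by
    by_contra hz
    obtain ⟨y, hy, k, hk, rfl⟩ := Finset.mem_mul.1
      (support_coeff_mul_subset _ _ (Finsupp.mem_support_iff.2 hz))
    rw [Finsupp.mem_support_iff, coeff_mul_single_apply, coeff_single_mul_apply, one_mul,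
      mul_one] at hy
    refine hconj _ (Finsupp.mem_support_iff.2 hy) (Finset.mem_image.2 ⟨k, hk, ?_⟩)
    group
  rw [eq_neg_of_add_eq_zero_left decomp, coeff_neg, Finsupp.neg_apply, coeff_eq_zero, neg_zero]
  rfl

theorem exists_coeff_mul_mul_coeff_eq_zero {H : Subgroup Γ} [UniqueProds H]
    {a b : MonoidAlgebra R Γ} (haH : (a.coeff.support : Set Γ) ⊆ H) (ha : a ≠ 0)
    (hbH : ∃ g ∈ b.coeff.support, g ∈ H) (hab : ∀ r, a * (single 1 r * b) = 0) :
    ∃ g h, a.coeff g ≠ 0 ∧ b.coeff h ≠ 0 ∧ ∀ r, a.coeff g * r * b.coeff h = 0 := by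
  have support_nonempty : a.coeff.support.Nonempty :=
    Finsupp.support_nonempty_iff.2 fun h => ha (coeff_injective h)
  obtain ⟨g, hg, h, hh, hunique⟩ := exists_uniqueMul_of_subset_subgroup support_nonempty haH hbH
  refine ⟨g, h, Finsupp.mem_support_iff.1 hg, Finsupp.mem_support_iff.1 hh, fun r => ?_⟩
  have support_subset : (single 1 r * b).coeff.support ⊆ b.coeff.support := fun k hk => by
    rw [Finsupp.mem_support_iff, coeff_single_one_mul] at hk
    exact Finsupp.mem_support_iff.2 (right_ne_zero_of_mul hk)
  have := coeff_mul_mul_of_uniqueMul (hunique.mono subset_rfl support_subset)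
  rwa [hab, coeff_single_one_mul, ← mul_assoc, eq_comm] at this

theorem exists_coeff_ne_zero {R : Type u} {M : Type v} [Semiring R] {a : MonoidAlgebra R M}
    (ha : a ≠ 0) : ∃ g, a.coeff g ≠ 0 :=
  Finsupp.ne_iff.1 fun h => ha (coeff_injective h)

theorem IsPrimeRing.monoidAlgebra (hR : IsPrimeRing R)
    (hΓ : ∀ N : Subgroup Γ, N.Normal → Finite N → N = ⊥) : IsPrimeRing (MonoidAlgebra R Γ) := by
  refine isPrimeRing_iff.2 fun a b hab => ?_
  by_contra! hne
  obtain ⟨g, hg⟩ := exists_coeff_ne_zero hne.1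
  obtain ⟨h, hh⟩ := exists_coeff_ne_zero hne.2
  set a' := single g⁻¹ 1 * a
  set b' := b * single h⁻¹ 1
  have ha' : a'.coeff 1 ≠ 0 := by simpa [a', coeff_single_mul_apply] using hg
  have hb' : b'.coeff 1 ≠ 0 := by simpa [b', coeff_mul_single_apply] using hh
  have mul_mul_eq_zero (s : MonoidAlgebra R Γ) : a' * s * b' = 0 := by
    rw [← mul_assoc, mul_assoc _ a, mul_assoc _ (a * s), hab, mul_zero, zero_mul]
  have fcPart_ne_zero : fcPart a' ≠ 0 := fun h0 => ha' <| by
    rw [← coeff_fcPart_of_mem a' (one_mem _), h0, coeff_zero, Finsupp.zero_apply]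
  have := uniqueProds_closure_of_subset_fcCenter hΓ (Finset.finite_toSet _)
    (support_fcPart_subset a')
  obtain ⟨x, y, hx, hy, hxy⟩ := exists_coeff_mul_mul_coeff_eq_zero
    Subgroup.subset_closure fcPart_ne_zero ⟨1, Finsupp.mem_support_iff.2 hb', one_mem _⟩
    fun r => fcPart_mul_eq_zero fun x => by rw [← mul_assoc, mul_assoc a', mul_mul_eq_zero]
  exact (hR.eq_zero_or_eq_zero hxy).elim hx hy

theorem IsPrimeRing.of_monoidAlgebra {M : Type v} [Monoid M]
    (h : IsPrimeRing (MonoidAlgebra R M)) : IsPrimeRing R := by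
  refine isPrimeRing_iff.2 fun x y hxy => ?_
  have := h.eq_zero_or_eq_zero (a := single 1 x) (b := single 1 y) fun s => by
    ext m
    rw [coeff_mul_single_one, coeff_single_one_mul, hxy, coeff_zero, Finsupp.zero_apply]
  simpa only [single_eq_zero] using this

variable (R) in
/-- The sum of the elements of a finite subgroup in the group ring, which is the norm element of
the subgroup. -/
noncomputable def subgroupSum (N : Subgroup Γ) [Fintype N] : MonoidAlgebra R Γ :=
  ∑ m : N, single (m : Γ) 1

theorem subgroupSum_mul_single {N : Subgroup Γ} [Fintype N] {n : Γ} (hn : n ∈ N) :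
    subgroupSum R N * single n 1 = subgroupSum R N := by
  simp only [subgroupSum, Finset.sum_mul, single_mul_single, mul_one]
  exact Equiv.sum_comp (Equiv.mulRight (⟨n, hn⟩ : N)) fun m : N => single (m : Γ) (1 : R)

theorem subgroupSum_ne_zero [Nontrivial R] (N : Subgroup Γ) [Fintype N] :
    subgroupSum R N ≠ 0 := fun h => by
  classical
  have := congrArg (fun c => coeff c 1) h
  simp [subgroupSum, coeff_sum, Finsupp.finsetSum_apply, Finsupp.single_apply] at this

theorem commute_subgroupSum_single (N : Subgroup Γ) [N.Normal] [Fintype N] (x : Γ) (r : R) :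
    Commute (subgroupSum R N) (single x r) := by
  simp only [Commute, SemiconjBy, subgroupSum, Finset.sum_mul, Finset.mul_sum, single_mul_single,
    mul_one, one_mul]
  rw [← (MulAut.conjNormal x : MulAut N).toEquiv.sum_comp]
  simp

theorem commute_subgroupSum (N : Subgroup Γ) [N.Normal] [Fintype N] (s : MonoidAlgebra R Γ) :
    Commute (subgroupSum R N) s := by
  rw [← sum_coeff_single s]
  exact Commute.sum_right _ _ _ fun _ _ => commute_subgroupSum_single N _ _

theorem eq_bot_of_isPrimeRing_monoidAlgebra [Nontrivial R]
    (h : IsPrimeRing (MonoidAlgebra R Γ)) (N : Subgroup Γ) [N.Normal] [Finite N] : N = ⊥ := by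
  refine (Subgroup.eq_bot_iff_forall N).2 fun n hn => ?_
  have := Fintype.ofFinite N
  have mul_eq_zero (s : MonoidAlgebra R Γ) : subgroupSum R N * s * (single n 1 - 1) = 0 := by
    rw [(commute_subgroupSum N s).eq, mul_assoc, mul_sub, subgroupSum_mul_single hn, mul_one,
      sub_self, mul_zero]
  have := (h.eq_zero_or_eq_zero mul_eq_zero).resolve_left (subgroupSum_ne_zero N)
  rw [sub_eq_zero, one_def] at this
  exact (single_left_inj one_ne_zero).1 this

theorem isPrimeRing_monoidAlgebra_iff [Nontrivial R] :
    IsPrimeRing (MonoidAlgebra R Γ) ↔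
      IsPrimeRing R ∧ ∀ N : Subgroup Γ, N.Normal → Finite N → N = ⊥ :=
  ⟨fun h => ⟨.of_monoidAlgebra h, fun N _ _ => eq_bot_of_isPrimeRing_monoidAlgebra h N⟩,
    fun ⟨hR, hΓ⟩ => hR.monoidAlgebra hΓ⟩

end GroupRing

/-! ### Groupoid rings and isotropy groups -/

namespace GroupoidRing

variable {R : Type u} {C : Type v} [Ring R] [Groupoid.{w} C]

theorem coeff_zero (g : GroupoidMor C) : (0 : GroupoidRing R C).coeff g = 0 :=
  rfl

theorem coeff_add (a b : GroupoidRing R C) (g : GroupoidMor C) :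
    (a + b).coeff g = a.coeff g + b.coeff g :=
  rfl

theorem coeff_single_of_ne {g h : GroupoidMor C} (hgh : g ≠ h) (r : R) :
    (single g r).coeff h = 0 :=
  Finsupp.single_eq_of_ne' hgh

theorem single_ne_zero {g : GroupoidMor C} {r : R} (hr : r ≠ 0) : single g r ≠ 0 :=
  Finsupp.single_ne_zero.2 hr

theorem exists_coeff_ne_zero {a : GroupoidRing R C} (ha : a ≠ 0) : ∃ g, a.coeff g ≠ 0 :=
  Finsupp.ne_iff.1 ha

theorem single_mk_mul_single_mk {x y z : C} (f : x ⟶ y) (g : y ⟶ z) (r s : R) :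
    (single ⟨y, z, g⟩ r * single ⟨x, y, f⟩ s : GroupoidRing R C) =
      single ⟨x, z, f ≫ g⟩ (r * s) := by
  rw [single_mul_single, singleMul, dif_pos rfl]
  simp [GroupoidMor.comp]

theorem single_mul_single_of_ne {g h : GroupoidMor C} (hgh : g.source ≠ h.range) (r s : R) :
    (single g r * single h s : GroupoidRing R C) = 0 := by
  rw [single_mul_single, singleMul, dif_neg hgh]

section Transport

variable {x y z v : C}

/-- The additive map `t ↦ δ_p t δ_q`. It carries the coefficients of `t` at the morphisms `x ⟶ y`
to the morphisms `v ⟶ z` and discards all others. -/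
noncomputable def transport (p : y ⟶ z) (q : v ⟶ x) : GroupoidRing R C →+ GroupoidRing R C where
  toFun t := single ⟨y, z, p⟩ 1 * t * single ⟨v, x, q⟩ 1
  map_zero' := by rw [mul_zero, zero_mul]
  map_add' a b := by rw [mul_add, add_mul]

theorem transport_apply (p : y ⟶ z) (q : v ⟶ x) (t : GroupoidRing R C) :
    transport p q t = single ⟨y, z, p⟩ 1 * t * single ⟨v, x, q⟩ 1 :=
  rfl

theorem transport_single (p : y ⟶ z) (q : v ⟶ x) (g : x ⟶ y) (r : R) :
    transport p q (single ⟨x, y, g⟩ r) = single ⟨v, z, q ≫ g ≫ p⟩ r := by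
  rw [transport_apply, single_mk_mul_single_mk, single_mk_mul_single_mk, one_mul, mul_one]

theorem transport_single_of_ne (p : y ⟶ z) (q : v ⟶ x) {g : GroupoidMor C}
    (hg : ¬ (g.source = x ∧ g.range = y)) (r : R) : transport p q (single g r) = 0 := by
  rw [transport_apply]
  by_cases hy : g.range = y
  · rw [mul_assoc, single_mul_single_of_ne fun hx => hg ⟨hx, hy⟩, mul_zero]
  · rw [single_mul_single_of_ne (Ne.symm hy), zero_mul]

theorem coeff_transport (p : y ⟶ z) (q : v ⟶ x) (t : GroupoidRing R C) (g : x ⟶ y) :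
    (transport p q t).coeff ⟨v, z, q ≫ g ≫ p⟩ = t.coeff ⟨x, y, g⟩ := by
  induction t using induction_linear with
  | h0 => rw [map_zero, coeff_zero, coeff_zero]
  | hadd a b ha hb => rw [map_add, coeff_add, coeff_add, ha, hb]
  | hs h r =>
    by_cases hh : h.source = x ∧ h.range = y
    · obtain ⟨x, y, h⟩ := h
      obtain ⟨rfl, rfl⟩ := hh
      rw [transport_single]
      by_cases hgh : h = g
      · rw [hgh]
        exact Finsupp.single_eq_same.trans Finsupp.single_eq_same.symm
      · rw [coeff_single_of_ne (by simpa [cancel_epi, cancel_mono] using hgh),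
          coeff_single_of_ne (by simpa using hgh)]
    · rw [transport_single_of_ne p q hh, coeff_zero, coeff_single_of_ne]
      rintro rfl
      exact hh ⟨rfl, rfl⟩

theorem transport_ne_zero (p : y ⟶ z) (q : v ⟶ x) {t : GroupoidRing R C} {g : x ⟶ y}
    (ht : t.coeff ⟨x, y, g⟩ ≠ 0) : transport p q t ≠ 0 := fun h => ht <| by
  rw [← coeff_transport p q, h, coeff_zero]

theorem transport_eq_zero_of_isEmpty [IsEmpty (x ⟶ y)] (p : y ⟶ z) (q : v ⟶ x)
    (t : GroupoidRing R C) : transport p q t = 0 := by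
  induction t using induction_linear with
  | h0 => rw [map_zero]
  | hadd a b ha hb => rw [map_add, ha, hb, add_zero]
  | hs g r =>
    refine transport_single_of_ne p q ?_ r
    rintro ⟨rfl, rfl⟩
    exact isEmptyElim g.hom

end Transport

theorem nonempty_hom_of_isPrimeRing [Nontrivial R] (h : IsPrimeRing (GroupoidRing R C))
    (e f : C) : Nonempty (e ⟶ f) := by
  by_contra hempty
  rw [not_nonempty_iff] at hempty
  exact (h.eq_zero_or_eq_zero (transport_eq_zero_of_isEmpty (R := R) (𝟙 f) (𝟙 e))).elim
    (single_ne_zero one_ne_zero) (single_ne_zero one_ne_zero)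

theorem isRDense_of_isPrimeRing [Nontrivial R] (h : IsPrimeRing (GroupoidRing R C)) (e : C) :
    IsRDense R (groupoidOrbit e) := fun _ ha =>
  (exists_coeff_ne_zero ha).imp fun g hg => ⟨hg, nonempty_hom_of_isPrimeRing h e g.source⟩

section Isotropy

variable {e : C}

variable (R e) in
/-- The inclusion of the group ring of an isotropy group into the groupoid ring, as an additive
map. -/
noncomputable def ofIsotropyAddHom : MonoidAlgebra R (End e) →+ GroupoidRing R C :=
  (Finsupp.mapDomain.addMonoidHom fun x : End e => (⟨e, e, x⟩ : GroupoidMor C)).comp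
    (MonoidAlgebra.coeffAddEquiv : MonoidAlgebra R (End e) ≃+ _).toAddMonoidHom

theorem ofIsotropyAddHom_single (x : End e) (r : R) :
    ofIsotropyAddHom R e (.single x r) = single ⟨e, e, x⟩ r :=
  Finsupp.mapDomain_single

variable (R e) in
/-- The inclusion of the group ring of an isotropy group into the groupoid ring. -/
noncomputable def ofIsotropy : MonoidAlgebra R (End e) →ₙ+* GroupoidRing R C where
  __ := ofIsotropyAddHom R e
  map_mul' a b := by
    change ofIsotropyAddHom R e (a * b) = ofIsotropyAddHom R e a * ofIsotropyAddHom R e b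
    induction a using MonoidAlgebra.induction_linear with
    | zero => rw [zero_mul, map_zero, zero_mul]
    | add a a' ha ha' => rw [add_mul, map_add, map_add, add_mul, ha, ha']
    | single x r =>
      induction b using MonoidAlgebra.induction_linear with
      | zero => rw [mul_zero, map_zero, mul_zero]
      | add b b' hb hb' => rw [mul_add, map_add, map_add, mul_add, hb, hb']
      | single y s =>
        simp only [MonoidAlgebra.single_mul_single, ofIsotropyAddHom_single,
          single_mk_mul_single_mk, End.mul_def]

theorem ofIsotropy_single (x : End e) (r : R) :
    ofIsotropy R e (.single x r) = single ⟨e, e, x⟩ r :=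
  ofIsotropyAddHom_single x r

theorem ofIsotropy_one : ofIsotropy R e 1 = single ⟨e, e, 𝟙 e⟩ 1 :=
  ofIsotropy_single 1 1

theorem ofIsotropy_injective : Function.Injective (ofIsotropy R e) :=
  (Finsupp.mapDomain_injective fun _ _ hxy => by cases hxy; rfl).comp
    MonoidAlgebra.coeff_injective

theorem exists_ofIsotropy_eq_transport {x y : C} (p : y ⟶ e) (q : e ⟶ x)
    (t : GroupoidRing R C) : ∃ s, ofIsotropy R e s = transport p q t := by
  induction t using induction_linear with
  | h0 => exact ⟨0, by rw [map_zero, map_zero]⟩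
  | hadd a b ha hb =>
    obtain ⟨⟨s, hs⟩, s', hs'⟩ := And.intro ha hb
    exact ⟨s + s', by rw [map_add, map_add, hs, hs']⟩
  | hs g r =>
    by_cases hg : g.source = x ∧ g.range = y
    · obtain ⟨x, y, g⟩ := g
      obtain ⟨rfl, rfl⟩ := hg
      exact ⟨.single (q ≫ g ≫ p) r, by rw [ofIsotropy_single, transport_single]⟩
    · exact ⟨0, by rw [map_zero, transport_single_of_ne p q hg]⟩

theorem ofIsotropy_mul_mul_ofIsotropy (a b : MonoidAlgebra R (End e)) (t : GroupoidRing R C) :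
    ofIsotropy R e a * t * ofIsotropy R e b =
      ofIsotropy R e a * transport (𝟙 e) (𝟙 e) t * ofIsotropy R e b := by
  conv_lhs => rw [← mul_one a, ← one_mul b, map_mul, map_mul, ofIsotropy_one]
  simp only [transport_apply, mul_assoc]

theorem isPrimeRing_isotropy (h : IsPrimeRing (GroupoidRing R C)) (e : C) :
    IsPrimeRing (MonoidAlgebra R (End e)) := by
  refine isPrimeRing_iff.2 fun a b hab => ?_
  have := h.eq_zero_or_eq_zero (a := ofIsotropy R e a) (b := ofIsotropy R e b) fun t => by
    obtain ⟨s, hs⟩ := exists_ofIsotropy_eq_transport (𝟙 e) (𝟙 e) t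
    rw [ofIsotropy_mul_mul_ofIsotropy, ← hs, ← map_mul, ← map_mul, hab, map_zero]
  simpa only [map_eq_zero_iff _ ofIsotropy_injective] using this

theorem isPrimeRing_of_isotropy (hd : IsRDense R (groupoidOrbit e))
    (h : IsPrimeRing (MonoidAlgebra R (End e))) : IsPrimeRing (GroupoidRing R C) := by
  have exists_transport_ne_zero (a : GroupoidRing R C) (ha : a ≠ 0) :
      ∃ (x y : C) (p : y ⟶ e) (q : e ⟶ x), transport p q a ≠ 0 := by
    obtain ⟨⟨x, y, g⟩, hg, ⟨q⟩⟩ := hd a ha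
    exact ⟨x, y, inv (q ≫ g), q, transport_ne_zero _ _ hg⟩
  refine isPrimeRing_iff.2 fun a b hab => ?_
  by_contra! hne
  obtain ⟨x, y, p, q, ha⟩ := exists_transport_ne_zero a hne.1
  obtain ⟨x', y', p', q', hb⟩ := exists_transport_ne_zero b hne.2
  obtain ⟨s, hs⟩ := exists_ofIsotropy_eq_transport p q a
  obtain ⟨s', hs'⟩ := exists_ofIsotropy_eq_transport p' q' b
  have mul_mul_eq_zero (t : MonoidAlgebra R (End e)) : s * t * s' = 0 := by
    apply ofIsotropy_injective
    rw [map_mul, map_mul, hs, hs', map_zero]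
    calc transport p q a * ofIsotropy R e t * transport p' q' b
        = single ⟨y, e, p⟩ 1 *
          (a * (single ⟨e, x, q⟩ 1 * ofIsotropy R e t * single ⟨y', e, p'⟩ 1) * b) *
          single ⟨e, x', q'⟩ 1 := by simp only [transport_apply, mul_assoc]
      _ = 0 := by rw [hab, mul_zero, zero_mul]
  rcases h.eq_zero_or_eq_zero mul_mul_eq_zero with rfl | rfl
  · exact ha (by rw [← hs, map_zero])
  · exact hb (by rw [← hs', map_zero])

end Isotropy

end GroupoidRing

theorem mainTheorem9_general {R : Type u} {C : Type v} [Ring R] [Nontrivial R] [Groupoid.{w} C]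
    [Nonempty C] :
    List.TFAE [
      IsPrimeRing (GroupoidRing R C),
      ∃ e : C, IsRDense R (groupoidOrbit e) ∧ IsPrimeRing (MonoidAlgebra R (End e)),
      ∃ e : C, IsRDense R (groupoidOrbit e) ∧ IsPrimeRing R ∧
        ∀ N : Subgroup (End e), N.Normal → Finite N → N = ⊥] := by
  tfae_have 1 → 2 := fun h =>
    let ⟨e⟩ := ‹Nonempty C›
    ⟨e, GroupoidRing.isRDense_of_isPrimeRing h e, GroupoidRing.isPrimeRing_isotropy h e⟩
  tfae_have 2 → 1 := fun ⟨_, hd, h⟩ => GroupoidRing.isPrimeRing_of_isotropy hd h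
  tfae_have 2 ↔ 3 := by simp only [isPrimeRing_monoidAlgebra_iff]
  tfae_finish

/-- The isotropy group of `e` is `End e`, whose product `g * h` is `g` after `h`. -/
theorem mainTheorem9 {R : Type u} {C : Type v} [CommRing R] [Nontrivial R] [Groupoid.{w} C]
    [Nonempty C] :
    List.TFAE [
      IsPrimeRing (GroupoidRing R C),
      ∃ e : C, IsRDense R (groupoidOrbit e) ∧ IsPrimeRing (MonoidAlgebra R (End e)),
      ∃ e : C, IsRDense R (groupoidOrbit e) ∧ IsDomain R ∧
        ∀ N : Subgroup (End e), N.Normal → Finite N → N = ⊥] := by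
  simpa only [isPrimeRing_iff_isDomain] using mainTheorem9_general (R := R) (C := C)
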